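/- Let $\mathbf{Sets}_\omega$ be the category of finite sets. A semi-galois category is a pair $\langle\mathscr{C},\mathrm{F}\rangle$ of an essentially small category $\mathscr{C}$ and a functor $\mathrm{F}:\mathscr{C}\to\mathbf{Sets}_\omega$ such that: $\mathscr{C}$ has an initial object $\emptyset_{\mathscr C}$, a final object $1_{\mathscr C}$, pullbacks and pushouts; every arrow of $\mathscr{C}$ is an epimorphism followed by a monomorphism; $\mathrm{F}(\emptyset_{\mathscr C})$ is empty and $\mathrm{F}(1_{\mathscr C})$ is a one-element set; $\mathrm{F}$ preserves pullbacks and pushouts and reflects isomorphisms. Its fundamental monoid $\pi_1(\mathscr{C},\mathrm{F})$ is the monoid of natural endomorphisms of $\mathrm{F}$, acting on the right on each $\mathrm{F}(X)$ (so $\phi\psi$ means first $\phi$, then $\psi$), with its profinite topology, i.e. the coarsest one for which all maps $\phi\mapsto \xi\cdot\phi_X$ into the discrete sets $\mathrm{F}(X)$ ($X\in\mathscr{C}$, $\xi\in\mathrm{F}(X)$) are continuous. Let $A$ be an alphabet (a finite non-empty set). A finite action over $A$ (equivalently, a deterministic finite automaton without initial and final states) is a finite set $S$ with a right action $S\times A^*\to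 S$ of the free monoid $A^*$; morphisms are the $A^*$-equivariant maps. A finite action is trivial if every word fixes every state. A local variety of finite actions over $A$ is a class $\mathscr{V}_A$ of finite actions over $A$ that contains all trivial finite actions and is closed under binary products, subactions (restrictions to $A^*$-stable subsets) and quotients (images under surjective equivariant maps). Let $\mathbf{DFA}(\mathscr{V}_A)$ be the category of the members of $\mathscr{V}_A$ and all equivariant maps between them, and $\mathrm{F}_{\mathscr{V}_A}:\mathbf{DFA}(\mathscr{V}_A)\to\mathbf{Sets}_\omega$ the functor taking an action to its set of states. Lemma. For every semi-galois category $\langle\mathscr{C},\mathrm{F}\rangle$ and every alphabet $A$, the following are equivalent: (1) there is a local variety $\mathscr{V}_A$ of finite actions over $A$ such that $\langle\mathscr{C},\mathrm{F}\rangle$ is equivalent to $\langle\mathbf{DFA}(\mathscr{V}_A),\mathrm{F}_{\mathscr{V}_A}\rangle$, i.e. there are an equivalence of categories $E:\mathscr{C}\to\mathbf{DFA}(\mathscr{V}_A)$ and a natural isomorphism $\mathrm{F}_{\mathscr{V}_A}\circ E\cong\mathrm{F}$; (2) $\pi_1(\mathscr{C},\mathrm{F})$ is topologically generated by $|A|$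 elements, i.e. there are $|A|$ (not necessarily distinct) elements of $\pi_1(\mathscr{C},\mathrm{F})$ that generate a dense submonoid. -/

import Mathlib

open CategoryTheory CategoryTheory.Limits

universe u v w x u' v'

namespace SemiGalois

section Categories

variable {C : Type u} [Category.{v} C]

/-- `F` is a fiber functor on `C`, that is, the pair `(C, F)` is a semi-galois category.
The category of finite sets is `FintypeCat`. -/
structure IsSemiGalois (F : C ⥤ FintypeCat.{w}) : Prop where
  essentiallySmall : EssentiallySmall.{w} C
  hasInitial : HasInitial C
  hasTerminal : HasTerminal C
  hasPullbacks : HasPullbacks C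
  hasPushouts : HasPushouts C
  exists_epi_mono : ∀ {X Y : C} (f : X ⟶ Y),
    ∃ (Z : C) (p : X ⟶ Z) (j : Z ⟶ Y), Epi p ∧ Mono j ∧ p ≫ j = f
  map_initial : ∀ X : C, Nonempty (IsInitial X) → IsEmpty (F.obj X)
  map_terminal : ∀ X : C, Nonempty (IsTerminal X) → Nonempty (Unique (F.obj X))
  preservesPullbacks : PreservesLimitsOfShape WalkingCospan F
  preservesPushouts : PreservesColimitsOfShape WalkingSpan F
  reflectsIsomorphisms : F.ReflectsIsomorphisms

/-- Equivalence of categories over finite sets: an equivalence `C ≌ D` compatible with the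
functors to finite sets up to natural isomorphism. -/
def FiberEquivalent {D : Type u'} [Category.{v'} D]
    (F : C ⥤ FintypeCat.{w}) (G : D ⥤ FintypeCat.{w}) : Prop :=
  ∃ e : C ≌ D, Nonempty (e.functor ⋙ G ≅ F)

/-- The fundamental monoid: natural endomorphisms of `F`. -/
@[ext]
structure FundamentalMonoid (F : C ⥤ FintypeCat.{w}) where
  /-- the underlying natural endomorphism -/
  hom : F ⟶ F

namespace FundamentalMonoid

variable {F : C ⥤ FintypeCat.{w}}

/-- The right action on the fibers: `act φ X ξ` is `ξ · φ_X`. -/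
def act (φ : FundamentalMonoid F) (X : C) (ξ : F.obj X) : F.obj X :=
  φ.hom.app X ξ

/-- `φ * ψ` is `φ` first, then `ψ`, so that `ξ · (φ * ψ) = (ξ · φ) · ψ`. -/
instance : Monoid (FundamentalMonoid F) where
  mul φ ψ := ⟨φ.hom ≫ ψ.hom⟩
  one := ⟨𝟙 F⟩
  mul_assoc _ _ _ := FundamentalMonoid.ext (Category.assoc _ _ _)
  one_mul _ := FundamentalMonoid.ext (Category.id_comp _)
  mul_one _ := FundamentalMonoid.ext (Category.comp_id _)

/-- The profinite topology: the coarsest one for which every orbit map `φ ↦ ξ · φ_X` into the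
finite discrete set `F X` is continuous. (For a semi-galois category every `ξ ∈ F X` is the image
of the root of a galois object, and for a galois object `(X, ξ)` the orbit map at `ξ` is the
projection to `End X ≃ F X`; so this is the inverse limit topology of the finite monoids `End X`
over the galois objects `(X, ξ)`.) -/
instance : TopologicalSpace (FundamentalMonoid F) :=
  ⨅ (X : C) (ξ : F.obj X), TopologicalSpace.induced (fun φ => act φ X ξ) ⊥

end FundamentalMonoid

/-- `M` is topologically generated by `n` (not necessarily distinct) elements: some family of `n`
elements generates a dense submonoid. -/
def IsTopologicallyGeneratedBy (M : Type*) [Monoid M] [TopologicalSpace M] (n : ℕ) : Prop :=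
  ∃ g : Fin n → M, Dense (Submonoid.closure (Set.range g) : Set M)

end Categories

section Automata

/-- A deterministic finite automaton (without initial and final states) over `A`, equivalently a
finite action over `A`: a finite set of states with a transition function. -/
structure FinAction (A : Type x) where
  /-- the set of states -/
  State : Type w
  [finite : Finite State]
  /-- the transition function on letters -/
  step : State → A → State

namespace FinAction

variable {A : Type x}

instance (s : FinAction.{w} A) : Finite s.State := s.finite

/-- The action `ξ · u` of words `u ∈ A*` on states: `ξ · ε = ξ` and `ξ · (w a) = (ξ · w) · a`. -/
def run (s : FinAction.{w} A) (ξ : s.State) (u : List A) : s.State :=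
  u.foldl s.step ξ

/-- The finite action given by a map `S × A* → S` satisfying the laws of an action. -/
def ofAct {S : Type w} [Finite S] (act : S → List A → S) : FinAction.{w} A where
  State := S
  step ξ a := act ξ [a]

/-- Finite actions in the form `S × A* → S` are the same as transition functions on letters. -/
theorem run_ofAct {S : Type w} [Finite S] (act : S → List A → S)
    (h_nil : ∀ ξ, act ξ [] = ξ) (h_append : ∀ ξ u v, act (act ξ u) v = act ξ (u ++ v))
    (ξ : S) (u : List A) : (ofAct act).run ξ u = act ξ u := by
  induction u generalizing ξ with
  | nil => exact (h_nil ξ).symm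
  | cons a u ih =>
    have h := ih (act ξ [a])
    rw [h_append] at h
    exact h

/-- Transition-preserving maps. -/
@[ext]
structure Hom (s t : FinAction.{w} A) where
  /-- the underlying map of states -/
  toFun : s.State → t.State
  map_run : ∀ (ξ : s.State) (u : List A), t.run (toFun ξ) u = toFun (s.run ξ u)

/-- The category of deterministic finite automata over `A`. -/
instance : Category (FinAction.{w} A) where
  Hom s t := Hom s t
  id s := ⟨id, fun _ _ => rfl⟩
  comp f g := ⟨g.toFun ∘ f.toFun, fun ξ u => by
    simp only [Function.comp_apply, g.map_run, f.map_run]⟩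

/-- The functor taking an automaton to its finite set of states. -/
def forgetFunctor (A : Type x) : FinAction.{w} A ⥤ FintypeCat.{w} where
  obj s := FintypeCat.of s.State
  map {s t} f := FintypeCat.homMk (X := FintypeCat.of s.State) (Y := FintypeCat.of t.State)
    (Hom.toFun f)

/-- A finite action is trivial if every word fixes every state. -/
def IsTrivial (s : FinAction.{w} A) : Prop :=
  ∀ (ξ : s.State) (u : List A), s.run ξ u = ξ

/-- The product of two finite actions. -/
def prod (s t : FinAction.{w} A) : FinAction.{w} A where
  State := s.State × t.State
  step ξ a := (s.step ξ.1 a, t.step ξ.2 a)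

theorem run_prod (s t : FinAction.{w} A) (ξ : s.State) (η : t.State) (u : List A) :
    (s.prod t).run (ξ, η) u = (s.run ξ u, t.run η u) := by
  induction u generalizing ξ η with
  | nil => rfl
  | cons a u ih => exact ih (s.step ξ a) (t.step η a)

/-- A set of states stable under all words. -/
def IsStable (s : FinAction.{w} A) (T : Set s.State) : Prop :=
  ∀ ξ ∈ T, ∀ u : List A, s.run ξ u ∈ T

/-- The subaction of `s` on a stable set of states. -/
def sub (s : FinAction.{w} A) (T : Set s.State) (hT : s.IsStable T) : FinAction.{w} A where
  State := T
  step ξ a := ⟨s.step ξ.1 a, hT ξ.1 ξ.2 [a]⟩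

/-- `t` is a quotient of `s`. -/
def IsQuotient (s t : FinAction.{w} A) : Prop :=
  ∃ p : s.State → t.State, Function.Surjective p ∧
    ∀ (ξ : s.State) (u : List A), p (s.run ξ u) = t.run (p ξ) u

/-- A local variety of finite actions over `A`. -/
structure IsLocalVariety (V : ObjectProperty (FinAction.{w} A)) : Prop where
  trivial_mem : ∀ s : FinAction.{w} A, s.IsTrivial → V s
  prod_mem : ∀ s t : FinAction.{w} A, V s → V t → V (s.prod t)
  sub_mem : ∀ (s : FinAction.{w} A) (T : Set s.State) (hT : s.IsStable T), V s → V (s.sub T hT)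
  quotient_mem : ∀ s t : FinAction.{w} A, V s → s.IsQuotient t → V t

/-- The category `DFA(V)`: the full subcategory of the category of automata on the members
of `V`. -/
abbrev DFACat (V : ObjectProperty (FinAction.{w} A)) := V.FullSubcategory

/-- The restriction of the forgetful functor to `DFA(V)`. -/
def fiberFunctor (V : ObjectProperty (FinAction.{w} A)) : DFACat V ⥤ FintypeCat.{w} :=
  V.ι ⋙ forgetFunctor A

end FinAction

end Automata

end SemiGalois

/-! Both directions compare words over `A` with elements of the fundamental monoid.

From generators to a variety: a family indexed by `A` makes every fiber a finite action, and the
variety consists of the quotients of fibers. By density (`mem_of_dense`) a subset of a fiber stable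
under the letters is stable under the whole monoid. The key fact is `exists_range_eq`: such a subset
is the fiber of a subobject. It holds because every point lifts to a rooted object (`exists_root`),
whose fiber is the single orbit of its root (`exists_act_eq`, a compactness argument). Applied to
graphs it gives fullness, and applied to kernel pairs it shows that every quotient of a fiber is
again a fiber, which is essential surjectivity.

From a variety to generators: letters are natural endomorphisms of the state functor. A basic
neighbourhood of `φ` concerns finitely many points, all images of one point `ξ`. The orbit of `ξ`
under words is a subaction, so it lies in the variety and is a fiber; naturality keeps `φ` inside
it, so some word acts on `ξ` as `φ` does. -/

namespace SemiGalois

/-! ### Exactness properties of the fiber functor. -/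

namespace IsSemiGalois

variable {C : Type u} [Category.{v} C] {F : C ⥤ FintypeCat.{w}}

theorem hasFiniteLimits (hF : IsSemiGalois F) : HasFiniteLimits C :=
  have := hF.hasTerminal
  have := hF.hasPullbacks
  hasFiniteLimits_of_hasTerminal_and_pullbacks

theorem hasFiniteColimits (hF : IsSemiGalois F) : HasFiniteColimits C :=
  have := hF.hasInitial
  have := hF.hasPushouts
  hasFiniteColimits_of_hasInitial_and_pushouts

theorem preservesFiniteLimits (hF : IsSemiGalois F) : PreservesFiniteLimits F := by
  have := hF.hasTerminal
  have := hF.hasPullbacks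
  have := hF.preservesPullbacks
  obtain ⟨hu⟩ := hF.map_terminal (⊤_ C) ⟨terminalIsTerminal⟩
  have ht : IsTerminal (F.obj (⊤_ C)) :=
    IsTerminal.ofUniqueHom (fun _ => FintypeCat.homMk fun _ => hu.default)
      fun _ _ => FintypeCat.hom_ext _ _ fun _ => hu.uniq _
  have := preservesTerminal_of_iso F (ht.uniqueUpToIso terminalIsTerminal)
  have : PreservesLimitsOfShape (Discrete.{0} PEmpty) F :=
    preservesLimitsOfShape_pempty_of_preservesTerminal F
  exact preservesFiniteLimits_of_preservesTerminal_and_pullbacks F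

theorem preservesFiniteColimits (hF : IsSemiGalois F) : PreservesFiniteColimits F := by
  have := hF.hasInitial
  have := hF.hasPushouts
  have := hF.preservesPushouts
  have hu := hF.map_initial (⊥_ C) ⟨initialIsInitial⟩
  have hi : IsInitial (F.obj (⊥_ C)) :=
    IsInitial.ofUniqueHom (fun _ => FintypeCat.homMk fun y => hu.elim y)
      fun _ _ => FintypeCat.hom_ext _ _ fun y => hu.elim y
  have := preservesInitial_of_iso F (initialIsInitial.uniqueUpToIso hi)
  have : PreservesColimitsOfShape (Discrete.{0} PEmpty) F :=
    preservesColimitsOfShape_pempty_of_preservesInitial F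
  exact preservesFiniteColimits_of_preservesInitial_and_pushouts F

theorem isIso_of_bijective (hF : IsSemiGalois F) {X Y : C} (f : X ⟶ Y)
    (hf : Function.Bijective (F.map f)) : IsIso f := by
  have := hF.reflectsIsomorphisms
  have : IsIso (F.map f) :=
    (FintypeCat.equivEquivIso (Equiv.ofBijective _ hf)).isIso_hom
  exact isIso_of_reflects_iso f F

/-- If `F` identifies two arrows, it sends their equalizer inclusion to an isomorphism, and `F`
reflects isomorphisms. -/
theorem faithful (hF : IsSemiGalois F) : F.Faithful where
  map_injective {X Y f g} h := by
    have := hF.hasFiniteLimits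
    have := hF.preservesFiniteLimits
    have := hF.reflectsIsomorphisms
    have hl := isLimitForkMapOfIsLimit F _ (equalizerIsEqualizer f g)
    have : IsIso (F.map (equalizer.ι f g)) := isIso_limit_cone_parallelPair_of_eq h hl
    have : IsIso (equalizer.ι f g) := isIso_of_reflects_iso _ F
    exact (cancel_epi (equalizer.ι f g)).1 (equalizer.condition f g)

theorem surjective_of_epi (hF : IsSemiGalois F) {X Y : C} (f : X ⟶ Y) [Epi f] :
    Function.Surjective (F.map f) := by
  have := hF.preservesPushouts
  exact ConcreteCategory.surjective_of_epi_of_preservesPushout (F.map f)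

theorem injective_of_mono (hF : IsSemiGalois F) {X Y : C} (f : X ⟶ Y) [Mono f] :
    Function.Injective (F.map f) := by
  have := hF.preservesPullbacks
  exact ConcreteCategory.injective_of_mono_of_preservesPullback (F.map f)

/-- Every arrow factors as one that is surjective on fibers followed by one that is injective
on fibers. -/
theorem exists_surjective_injective (hF : IsSemiGalois F) {X Y : C} (f : X ⟶ Y) :
    ∃ (Z : C) (p : X ⟶ Z) (j : Z ⟶ Y), Function.Surjective (F.map p) ∧
      Function.Injective (F.map j) ∧ p ≫ j = f := by
  obtain ⟨Z, p, j, hp, hj, h⟩ := hF.exists_epi_mono f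
  exact ⟨Z, p, j, hF.surjective_of_epi p, hF.injective_of_mono j, h⟩

theorem exists_prod (hF : IsSemiGalois F) (X Y : C) :
    ∃ (P : C) (p : P ⟶ X) (q : P ⟶ Y),
      Function.Bijective fun z : F.obj P => (F.map p z, F.map q z) := by
  have := hF.hasFiniteLimits
  have := hF.preservesFiniteLimits
  let h := mapIsLimitOfPreservesOfIsLimit (F ⋙ FintypeCat.incl) _ _ (prodIsProd X Y)
  let h' := Types.binaryProductLimit ((F ⋙ FintypeCat.incl).obj X) ((F ⋙ FintypeCat.incl).obj Y)
  refine ⟨X ⨯ Y, prod.fst, prod.snd, ?_⟩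
  have e := (h.conePointUniqueUpToIso h').toEquiv.bijective
  convert! e using 1

theorem coprod_jointly_surjective (hF : IsSemiGalois F) [HasBinaryCoproducts C] {X Y : C}
    (z : F.obj (X ⨿ Y)) :
    (∃ a, F.map (coprod.inl : X ⟶ X ⨿ Y) a = z) ∨ ∃ b, F.map (coprod.inr : Y ⟶ X ⨿ Y) b = z := by
  have := hF.preservesFiniteColimits
  obtain ⟨⟨j⟩, a, h⟩ := FintypeCat.jointly_surjective _ _
    (isColimitOfPreserves F (coprodIsCoprod X Y)) z
  cases j
  · exact .inl ⟨a, h⟩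
  · exact .inr ⟨a, h⟩

/-- Fibers of coequalizers are coequalizers of fibers. -/
theorem exists_coequalizer (hF : IsSemiGalois F) {X Y : C} (f g : X ⟶ Y) :
    ∃ (Q : C) (q : Y ⟶ Q), f ≫ q = g ≫ q ∧ Function.Surjective (F.map q) ∧
      ∀ (T : Type w) [Finite T] (t : F.obj Y → T), (∀ z, t (F.map f z) = t (F.map g z)) →
        ∃ k : F.obj Q → T, ∀ y, k (F.map q y) = t y := by
  have := hF.hasFiniteColimits
  have := hF.preservesFiniteColimits
  refine ⟨coequalizer f g, coequalizer.π f g, coequalizer.condition f g,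
    hF.surjective_of_epi _, fun T _ t ht => ?_⟩
  have hl := isColimitCoforkMapOfIsColimit F _ (coequalizerIsCoequalizer f g)
  obtain ⟨k, hk⟩ := Cofork.IsColimit.desc' hl
    (FintypeCat.homMk (X := F.obj Y) (Y := FintypeCat.of T) t)
    (FintypeCat.hom_ext _ _ ht)
  exact ⟨k, fun y => ConcreteCategory.congr_hom hk y⟩

/-- Every finite set is the image of the fiber of a coproduct of terminal objects. -/
theorem exists_constant (hF : IsSemiGalois F) (S : Type w) [Finite S] :
    ∃ (X : C) (p : F.obj X → S), Function.Surjective p ∧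
      ∀ (φ : FundamentalMonoid F) (ξ : F.obj X), φ.act X ξ = ξ := by
  have := hF.hasFiniteLimits
  have := hF.hasFiniteColimits
  have := hF.preservesFiniteColimits
  obtain ⟨hu⟩ := hF.map_terminal (⊤_ C) ⟨terminalIsTerminal⟩
  let e := Finite.equivFin S
  let f : Fin (Nat.card S) → C := fun _ => ⊤_ C
  have hl := isColimitOfPreserves F (coproductIsCoproduct f)
  let c : Cocone (Discrete.functor f ⋙ F) :=
    ⟨FintypeCat.of S, Discrete.natTrans fun i => FintypeCat.homMk fun _ => e.symm i.as⟩
  refine ⟨∐ f, hl.desc c, fun s => ⟨F.map (Sigma.ι f (e s)) hu.default, ?_⟩, fun φ ξ => ?_⟩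
  · have := ConcreteCategory.congr_hom (hl.fac c ⟨e s⟩) hu.default
    refine Eq.trans this ?_
    exact e.symm_apply_apply s
  · obtain ⟨j, a, rfl⟩ := FintypeCat.jointly_surjective _ _ hl ξ
    refine (ConcreteCategory.congr_hom (φ.hom.naturality (Sigma.ι f j.as)) a).trans ?_
    exact congrArg (F.map (Sigma.ι f j.as)) ((hu.uniq _).trans (hu.uniq _).symm)

theorem isCofiltered_elements (hF : IsSemiGalois F) :
    IsCofiltered (F ⋙ FintypeCat.incl).Elements := by
  have := hF.hasFiniteLimits
  have := hF.preservesFiniteLimits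
  exact (F ⋙ FintypeCat.incl).isCofiltered_elements

end IsSemiGalois
end SemiGalois

/-! ### Rooted objects and subsets stable under the fundamental monoid. -/

namespace SemiGalois

variable {C : Type u} [Category.{v} C] {F : C ⥤ FintypeCat.{w}}

namespace FundamentalMonoid

theorem act_mul (φ ψ : FundamentalMonoid F) (X : C) (ξ : F.obj X) :
    act (φ * ψ) X ξ = act ψ X (act φ X ξ) := rfl

theorem act_map (φ : FundamentalMonoid F) {X Y : C} (f : X ⟶ Y) (ξ : F.obj X) :
    act φ Y (F.map f ξ) = F.map f (act φ X ξ) :=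
  ConcreteCategory.congr_hom (φ.hom.naturality f) ξ

theorem isOpen_setOf_act_mem (X : C) (ξ : F.obj X) (S : Set (F.obj X)) :
    IsOpen {φ : FundamentalMonoid F | act φ X ξ ∈ S} := by
  refine IsOpen.mono (t₂ := TopologicalSpace.induced (fun φ => act φ X ξ) ⊥) ?_
    (iInf₂_le (f := fun X (ξ : F.obj X) =>
      TopologicalSpace.induced (fun φ : FundamentalMonoid F => act φ X ξ) ⊥) X ξ)
  exact ⟨S, trivial, rfl⟩

theorem nhds_hasBasis (φ : FundamentalMonoid F) :
    (nhds φ).HasBasis (fun t : Set (Σ X : C, F.obj X) => t.Finite)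
      fun t => ⋂ i ∈ t, {ψ | act ψ i.1 i.2 = act φ i.1 i.2} := by
  have h : nhds φ = ⨅ i : Σ X : C, F.obj X,
      Filter.principal {ψ | act ψ i.1 i.2 = act φ i.1 i.2} := by
    rw [iInf_sigma]
    refine (nhds_iInf (a := φ)).trans (iInf_congr fun X => nhds_iInf.trans (iInf_congr fun ξ => ?_))
    let _ : TopologicalSpace (F.obj X) := ⊥
    have : DiscreteTopology (F.obj X) := ⟨rfl⟩
    refine (nhds_induced _ _).trans ?_
    rw [nhds_discrete, Filter.comap_pure]
    rfl
  rw [h]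
  exact Filter.hasBasis_iInf_principal_finite _

/-- Moving `ξ` out of `S` is an open condition, so if `φ` did it, some product of generators would
too. -/
theorem mem_of_dense {ι : Type*} {g : ι → FundamentalMonoid F}
    (hg : Dense (Submonoid.closure (Set.range g) : Set (FundamentalMonoid F)))
    {X : C} {S : Set (F.obj X)} (hS : ∀ ξ ∈ S, ∀ i, act (g i) X ξ ∈ S)
    (φ : FundamentalMonoid F) {ξ : F.obj X} (hξ : ξ ∈ S) : act φ X ξ ∈ S := by
  by_contra hφ
  obtain ⟨ψ, hψ, hψg⟩ := hg.inter_open_nonempty _ (isOpen_setOf_act_mem X ξ Sᶜ) ⟨φ, hφ⟩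
  refine hψ ?_
  have key : ∀ ψ ∈ Submonoid.closure (Set.range g), ∀ ξ ∈ S, act ψ X ξ ∈ S := by
    intro ψ hψ
    induction hψ using Submonoid.closure_induction with
    | mem _ h => obtain ⟨i, rfl⟩ := h; exact fun ξ hξ => hS ξ hξ i
    | one => exact fun ξ hξ => hξ
    | mul φ ψ _ _ h₁ h₂ => exact fun ξ hξ => h₂ _ (h₁ ξ hξ)
  exact key ψ hψg ξ hξ

end FundamentalMonoid

/-- `(Z, ζ)` is rooted: every arrow into `Z` whose fiber hits `ζ` is surjective on fibers. -/
def IsRoot (F : C ⥤ FintypeCat.{w}) (Z : C) (ζ : F.obj Z) : Prop :=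
  ∀ (W : C) (n : W ⟶ Z) (ω : F.obj W), F.map n ω = ζ → Function.Surjective (F.map n)

namespace IsSemiGalois

open FundamentalMonoid

/-- Among the objects over `X` with a point above `ξ`, one with the smallest fiber is rooted: the
image of an arrow hitting its point is another such object, so it cannot be smaller. -/
theorem exists_root (hF : IsSemiGalois F) {X : C} (ξ : F.obj X) :
    ∃ (Z : C) (m : Z ⟶ X) (ζ : F.obj Z), F.map m ζ = ξ ∧ IsRoot F Z ζ := by
  classical
  have hne : ∃ n, ∃ (Z : C) (m : Z ⟶ X) (ζ : F.obj Z), F.map m ζ = ξ ∧ Nat.card (F.obj Z) = n :=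
    ⟨_, X, 𝟙 X, ξ, by simp, rfl⟩
  obtain ⟨Z, m, ζ, hm, hc⟩ := Nat.find_spec hne
  refine ⟨Z, m, ζ, hm, fun W n ω hω => ?_⟩
  obtain ⟨I, p, j, hp, hj, rfl⟩ := hF.exists_surjective_injective n
  have hle : Nat.card (F.obj Z) ≤ Nat.card (F.obj I) := by
    rw [hc]
    refine Nat.find_min' hne ⟨I, j ≫ m, F.map p ω, ?_, rfl⟩
    rw [← hm, ← hω]
    simp
  have hb : Function.Bijective (F.map j) :=
    Function.Injective.bijective_of_nat_card_le hj hle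
  simpa using! hb.2.comp hp

/-- Compactness: over the pointed objects above `(Z, ζ)`, the candidate images of the base point,
those lying over `η`, form a cofiltered system of finite sets, nonempty because `ζ` is a root. A
section of it determines `φ`. -/
theorem exists_act_eq (hF : IsSemiGalois F) {Z : C} {ζ : F.obj Z} (hZ : IsRoot F Z ζ)
    (η : F.obj Z) : ∃ φ : FundamentalMonoid F, act φ Z ζ = η := by
  have := hF.isCofiltered_elements
  let E := (F ⋙ FintypeCat.incl).Elements
  let z : E := ⟨Z, ζ⟩
  let H : Over z ⥤ Type w :=
    { obj := fun a => {y : F.obj a.left.1 // F.map a.hom.1 y = η}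
      map := fun {a b} f => TypeCat.ofHom fun y => ⟨F.map f.left.1 y.1, by
        have h : f.left.1 ≫ b.hom.1 = a.hom.1 := congrArg Subtype.val (Over.w f)
        exact ((ConcreteCategory.congr_hom (F.map_comp f.left.1 b.hom.1) y.1).symm.trans
          (ConcreteCategory.congr_hom (congrArg (fun t => F.map t) h) y.1)).trans y.2⟩
      map_id := fun a => by ext y; exact ConcreteCategory.congr_hom (F.map_id _) y.1
      map_comp := fun f g => by ext y; exact ConcreteCategory.congr_hom (F.map_comp _ _) y.1 }
  have : ∀ a, Finite (H.obj a) := fun a => inferInstanceAs (Finite {y : F.obj a.left.1 // _})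
  have : ∀ a, Nonempty (H.obj a) := fun a =>
    let ⟨y, hy⟩ := hZ a.left.1 a.hom.1 a.left.2 a.hom.2 η
    ⟨⟨y, hy⟩⟩
  obtain ⟨s, hs⟩ := nonempty_sections_of_finite_cofiltered_system H
  -- The value assigned to a point does not depend on the pointed object it is reached from: a
  -- common refinement equalizes the two routes.
  have hind : ∀ {X : C} (a b : Over z) (f : a.left.1 ⟶ X) (g : b.left.1 ⟶ X),
      F.map f a.left.2 = F.map g b.left.2 → F.map f (s a).1 = F.map g (s b).1 := by
    intro X a b f g h
    obtain ⟨c, i, j, -⟩ := IsCofilteredOrEmpty.cone_objs a b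
    let x : E := ⟨X, F.map f a.left.2⟩
    let f' : a.left ⟶ x := ⟨f, rfl⟩
    let g' : b.left ⟶ x := ⟨g, h.symm⟩
    let d := IsCofiltered.eq (i.left ≫ f') (j.left ≫ g')
    let k : d ⟶ c.left := IsCofiltered.eqHom _ _
    have hk : k ≫ i.left ≫ f' = k ≫ j.left ≫ g' := IsCofiltered.eq_condition _ _
    let c' : Over z := Over.mk (k ≫ c.hom)
    let k' : c' ⟶ c := Over.homMk k
    have h1 : F.map (k'.left.1 ≫ i.left.1) (s c').1 = (s a).1 :=
      congrArg Subtype.val (hs (k' ≫ i))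
    have h2 : F.map (k'.left.1 ≫ j.left.1) (s c').1 = (s b).1 :=
      congrArg Subtype.val (hs (k' ≫ j))
    have h3 : k.1 ≫ i.left.1 ≫ f = k.1 ≫ j.left.1 ≫ g := congrArg Subtype.val hk
    rw [← h1, ← h2]
    have h4 := ConcreteCategory.congr_hom (congrArg (fun t => F.map t) h3) (s c').1
    simpa using! h4
  have hex : ∀ (X : C) (ξ : F.obj X), ∃ (a : Over z) (f : a.left.1 ⟶ X),
      F.map f a.left.2 = ξ := by
    intro X ξ
    obtain ⟨c, i, j, -⟩ := IsCofilteredOrEmpty.cone_objs z (⟨X, ξ⟩ : E)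
    exact ⟨Over.mk i, j.1, j.2⟩
  choose a f hf using hex
  refine ⟨⟨{ app := fun X => FintypeCat.homMk fun ξ => F.map (f X ξ) (s (a X ξ)).1
             naturality := fun X Y h => FintypeCat.hom_ext _ _ fun ξ => ?_ }⟩, ?_⟩
  · change F.map (f Y (F.map h ξ)) _ = F.map h (F.map (f X ξ) _)
    have := hind (a Y (F.map h ξ)) (a X ξ) (f Y (F.map h ξ)) (f X ξ ≫ h) (by simp [hf])
    simpa using! this
  · have := hind (a Z ζ) (Over.mk (𝟙 z)) (f Z ζ) (𝟙 Z) (by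
      rw [hf]
      exact (ConcreteCategory.congr_hom (F.map_id Z) ζ).symm)
    exact this.trans (s (Over.mk (𝟙 z))).2

/-- A subset of a fiber that is stable under the fundamental monoid is the fiber of a
subobject. -/
theorem exists_range_eq (hF : IsSemiGalois F) {X : C} (S : Set (F.obj X))
    (hS : ∀ ξ ∈ S, ∀ φ : FundamentalMonoid F, act φ X ξ ∈ S) :
    ∃ (Z : C) (m : Z ⟶ X), Function.Injective (F.map m) ∧ Set.range (F.map m) = S := by
  have := hF.hasFiniteColimits
  suffices h : ∃ (Z : C) (m : Z ⟶ X), Set.range (F.map m) = S by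
    obtain ⟨Z, m, rfl⟩ := h
    obtain ⟨I, p, j, hp, hj, rfl⟩ := hF.exists_surjective_injective m
    refine ⟨I, j, hj, ?_⟩
    rw [F.map_comp]
    exact (hp.range_comp (F.map j)).symm
  -- The set is covered point by point with a coproduct of rooted objects; each contributes only the
  -- orbit of its root, which stays in `S`.
  suffices h : ∀ T : Set (F.obj X), T.Finite → T ⊆ S →
      ∃ (Z : C) (m : Z ⟶ X), T ⊆ Set.range (F.map m) ∧ Set.range (F.map m) ⊆ S by
    obtain ⟨Z, m, h₁, h₂⟩ := h S S.toFinite subset_rfl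
    exact ⟨Z, m, h₂.antisymm h₁⟩
  intro T hT
  induction T, hT using Set.Finite.induction_on with
  | empty =>
    have := hF.map_initial (⊥_ C) ⟨initialIsInitial⟩
    exact fun _ => ⟨⊥_ C, initial.to X, Set.empty_subset _, by
      rintro _ ⟨y, -⟩
      exact isEmptyElim y⟩
  | @insert ξ T _ _ ih =>
    intro hTS
    obtain ⟨hξ, hT⟩ := Set.insert_subset_iff.1 hTS
    obtain ⟨Z, m, h₁, h₂⟩ := ih hT
    obtain ⟨W, n, ω, rfl, hW⟩ := hF.exists_root ξ
    refine ⟨Z ⨿ W, coprod.desc m n, ?_, ?_⟩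
    · refine Set.insert_subset ⟨F.map coprod.inr ω, ?_⟩ fun t ht => ?_
      · rw [← FintypeCat.comp_apply, ← F.map_comp, coprod.inr_desc]
      · obtain ⟨y, rfl⟩ := h₁ ht
        refine ⟨F.map coprod.inl y, ?_⟩
        rw [← FintypeCat.comp_apply, ← F.map_comp, coprod.inl_desc]
    · rintro _ ⟨y, rfl⟩
      rcases hF.coprod_jointly_surjective y with ⟨y, rfl⟩ | ⟨y, rfl⟩
      · rw [← FintypeCat.comp_apply, ← F.map_comp, coprod.inl_desc]
        exact h₂ ⟨y, rfl⟩
      · rw [← FintypeCat.comp_apply, ← F.map_comp, coprod.inr_desc]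
        obtain ⟨φ, rfl⟩ := hF.exists_act_eq hW y
        rw [← act_map]
        exact hS _ hξ φ

/-- Equivariant maps of fibers come from arrows. -/
theorem exists_map_eq (hF : IsSemiGalois F) {X Y : C} (t : F.obj X → F.obj Y)
    (ht : ∀ (φ : FundamentalMonoid F) (ξ : F.obj X), act φ Y (t ξ) = t (act φ X ξ)) :
    ∃ f : X ⟶ Y, ∀ ξ, F.map f ξ = t ξ := by
  obtain ⟨P, p, q, hpq⟩ := hF.exists_prod X Y
  -- The graph of `t` is stable, hence a subobject of the product; its projection to `X` is
  -- bijective on fibers, hence invertible.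
  obtain ⟨Z, m, hm, hZ⟩ := hF.exists_range_eq {z | F.map q z = t (F.map p z)} (by
    intro ξ hξ φ
    change F.map q _ = t (F.map p _)
    rw [← act_map, ← act_map, ← ht]
    exact congrArg _ hξ)
  have hZ' : ∀ z, F.map q (F.map m z) = t (F.map p (F.map m z)) := fun z =>
    hZ.subset ⟨z, rfl⟩
  have : IsIso (m ≫ p) := hF.isIso_of_bijective _ (by
    rw [F.map_comp]
    constructor
    · intro a b (h : F.map p (F.map m a) = F.map p (F.map m b))
      exact hm (hpq.1 (Prod.ext h (by
        change F.map q _ = F.map q _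
        rw [hZ', hZ', h])))
    · intro ξ
      obtain ⟨z, hz⟩ := hpq.2 (ξ, t ξ)
      have h1 : F.map p z = ξ := congrArg Prod.fst hz
      have h2 : F.map q z = t ξ := congrArg Prod.snd hz
      obtain ⟨y, rfl⟩ := hZ.superset (show z ∈ {z | F.map q z = t (F.map p z)} from by
        change F.map q z = t (F.map p z)
        rw [h1, h2])
      exact ⟨y, h1⟩)
  refine ⟨inv (m ≫ p) ≫ m ≫ q, fun ξ => ?_⟩
  have h : F.map p (F.map m (F.map (inv (m ≫ p)) ξ)) = ξ := by
    simp only [← FintypeCat.comp_apply, ← F.map_comp]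
    simp
  have h' := hZ' (F.map (inv (m ≫ p)) ξ)
  rw [h] at h'
  simpa using h'

end IsSemiGalois
end SemiGalois

/-! ### Finite actions and the variety attached to a generating family. -/

namespace SemiGalois

open FundamentalMonoid

namespace FinAction

variable {A : Type x}

theorem map_run_of_step {s t : FinAction.{w} A} {f : s.State → t.State}
    (hf : ∀ ξ a, t.step (f ξ) a = f (s.step ξ a)) (ξ : s.State) (u : List A) :
    t.run (f ξ) u = f (s.run ξ u) := by
  induction u generalizing ξ with
  | nil => rfl
  | cons a u ih =>
    change t.run (t.step (f ξ) a) u = _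
    rw [hf]
    exact ih _

theorem run_append (s : FinAction.{w} A) (ξ : s.State) (u v : List A) :
    s.run ξ (u ++ v) = s.run (s.run ξ u) v :=
  List.foldl_append

theorem run_sub (s : FinAction.{w} A) {T : Set s.State} (hT : s.IsStable T) (ξ : T)
    (u : List A) : ((s.sub T hT).run ξ u).1 = s.run ξ.1 u :=
  (map_run_of_step (s := s.sub T hT) (t := s) (f := Subtype.val) (fun _ _ => rfl) ξ u).symm

theorem isStable_range_run (s : FinAction.{w} A) (ξ : s.State) :
    s.IsStable (Set.range (s.run ξ)) := by
  rintro _ ⟨u, rfl⟩ v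
  exact ⟨u ++ v, s.run_append ξ u v⟩

end FinAction

section LetterAction

variable {C : Type u} [Category.{v} C] {F : C ⥤ FintypeCat.{w}} {A : Type x}

/-- A family of elements of the fundamental monoid indexed by an alphabet makes every fiber a
finite action. -/
def letterAction (g : A → FundamentalMonoid F) : C ⥤ FinAction.{w} A where
  obj X :=
    { State := F.obj X
      step := fun ξ a => act (g a) X ξ }
  map f := ⟨F.map f, FinAction.map_run_of_step fun ξ a => act_map (g a) f ξ⟩
  map_id X := FinAction.Hom.ext (funext fun ξ => ConcreteCategory.congr_hom (F.map_id X) ξ)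
  map_comp f h :=
    FinAction.Hom.ext (funext fun ξ => ConcreteCategory.congr_hom (F.map_comp f h) ξ)

/-- The finite actions that are quotients of fibers. -/
def letterVariety (g : A → FundamentalMonoid F) : ObjectProperty (FinAction.{w} A) :=
  fun s => ∃ X : C, ((letterAction g).obj X).IsQuotient s

/-- The graph of `t` in the fiber of a product is stable under the generators, hence under all of
the monoid. -/
theorem act_map_of_dense {g : A → FundamentalMonoid F}
    (hg : Dense (Submonoid.closure (Set.range g) : Set (FundamentalMonoid F)))
    (hF : IsSemiGalois F) {X Y : C} {t : F.obj X → F.obj Y}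
    (ht : ∀ a ξ, act (g a) Y (t ξ) = t (act (g a) X ξ)) (φ : FundamentalMonoid F)
    (ξ : F.obj X) : act φ Y (t ξ) = t (act φ X ξ) := by
  obtain ⟨P, p, q, hpq⟩ := hF.exists_prod X Y
  obtain ⟨z, hz⟩ := hpq.2 (ξ, t ξ)
  have hp : F.map p z = ξ := congrArg Prod.fst hz
  have hq : F.map q z = t ξ := congrArg Prod.snd hz
  have h := mem_of_dense hg (S := {z | F.map q z = t (F.map p z)}) (fun ξ hξ a => by
    change F.map q _ = t (F.map p _)
    rw [← act_map, ← act_map, ← ht]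
    exact congrArg _ hξ) φ (ξ := z) (by
      change F.map q z = t (F.map p z)
      rw [hp, hq])
  change F.map q _ = t (F.map p _) at h
  rwa [← act_map, ← act_map, hp, hq] at h

/-- Quotients of fibers are isomorphic to fibers. -/
theorem exists_bijective_of_letterVariety {g : A → FundamentalMonoid F}
    (hg : Dense (Submonoid.closure (Set.range g) : Set (FundamentalMonoid F)))
    (hF : IsSemiGalois F) {s : FinAction.{w} A} (hs : letterVariety g s) :
    ∃ (X : C) (p : F.obj X → s.State), Function.Bijective p ∧
      ∀ ξ a, s.step (p ξ) a = p (act (g a) X ξ) := by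
  obtain ⟨X, (p : F.obj X → s.State), hp, hps⟩ := hs
  replace hps : ∀ (ξ : F.obj X) a, s.step (p ξ) a = p (act (g a) X ξ) := fun ξ a => (hps ξ [a]).symm
  obtain ⟨P, p₁, p₂, hP⟩ := hF.exists_prod X X
  -- The kernel pair of `p` is stable, so it is the fiber of an object `R`; the coequalizer of the
  -- two projections of `R` has the quotient as its fiber.
  obtain ⟨R, r, -, hR⟩ := hF.exists_range_eq {z | p (F.map p₁ z) = p (F.map p₂ z)}
    (fun ξ hξ φ => mem_of_dense hg (fun ξ hξ a => by
      change p (F.map p₁ _) = p (F.map p₂ _)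
      rw [← act_map, ← act_map, ← hps, ← hps]
      exact congrArg (s.step · a) hξ) φ hξ)
  obtain ⟨Q, q, hq, hqs, hdesc⟩ := hF.exists_coequalizer (r ≫ p₁) (r ≫ p₂)
  obtain ⟨k, hk⟩ := hdesc s.State p fun z => by
    have h : F.map r z ∈ {z | p (F.map p₁ z) = p (F.map p₂ z)} := hR.subset ⟨z, rfl⟩
    simpa using! h
  refine ⟨Q, k, ⟨fun a b hab => ?_, fun y => ?_⟩, fun ξ a => ?_⟩
  · obtain ⟨a, rfl⟩ := hqs a
    obtain ⟨b, rfl⟩ := hqs b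
    obtain ⟨z, hz⟩ := hP.2 (a, b)
    have h₁ : F.map p₁ z = a := congrArg Prod.fst hz
    have h₂ : F.map p₂ z = b := congrArg Prod.snd hz
    rw [hk, hk] at hab
    obtain ⟨y, rfl⟩ := hR.superset (show z ∈ {z | p (F.map p₁ z) = p (F.map p₂ z)} from by
      change p (F.map p₁ z) = p (F.map p₂ z)
      rw [h₁, h₂, hab])
    rw [← h₁, ← h₂]
    simpa using! ConcreteCategory.congr_hom (congrArg (fun t => F.map t) hq) y
  · obtain ⟨ξ, rfl⟩ := hp y
    exact ⟨F.map q ξ, hk ξ⟩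
  · obtain ⟨ξ, rfl⟩ := hqs ξ
    rw [act_map, hk, hk, hps]

theorem isLocalVariety_letterVariety {g : A → FundamentalMonoid F}
    (hg : Dense (Submonoid.closure (Set.range g) : Set (FundamentalMonoid F)))
    (hF : IsSemiGalois F) : FinAction.IsLocalVariety (letterVariety g) where
  trivial_mem s hs := by
    obtain ⟨X, p, hp, hX⟩ := hF.exists_constant s.State
    refine ⟨X, p, hp, fun ξ u => (FinAction.map_run_of_step
      (s := (letterAction g).obj X) (fun ξ a => ?_) ξ u).symm⟩
    exact (hs _ [a]).trans (congrArg p (hX (g a) ξ).symm)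
  prod_mem s t := by
    rintro ⟨X, p, hp, hps⟩ ⟨Y, q, hq, hqt⟩
    obtain ⟨P, p₁, p₂, hP⟩ := hF.exists_prod X Y
    refine ⟨P, fun z => (p (F.map p₁ z), q (F.map p₂ z)), (hp.prodMap hq).comp hP.2,
      fun z u => (FinAction.map_run_of_step (s := (letterAction g).obj P) (t := s.prod t)
        (f := fun z => (p (F.map p₁ z), q (F.map p₂ z))) (fun z a => ?_) z u).symm⟩
    refine Prod.ext ?_ ?_
    · exact (hps _ [a]).symm.trans (congrArg p (act_map (g a) p₁ z))
    · exact (hqt _ [a]).symm.trans (congrArg q (act_map (g a) p₂ z))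
  sub_mem s T hT := by
    rintro ⟨X, (p : F.obj X → s.State), hp, hps⟩
    replace hps : ∀ (ξ : F.obj X) a, s.step (p ξ) a = p (act (g a) X ξ) := fun ξ a => (hps ξ [a]).symm
    obtain ⟨Z, m, hm, hZ⟩ := hF.exists_range_eq (p ⁻¹' T)
      (fun ξ hξ φ => mem_of_dense hg (fun ξ hξ a => by
        change p _ ∈ T
        rw [← hps]
        exact hT _ hξ [a]) φ hξ)
    refine ⟨Z, fun z => ⟨p (F.map m z), hZ.subset ⟨z, rfl⟩⟩, fun y => ?_, fun z u =>
      (FinAction.map_run_of_step (s := (letterAction g).obj Z) (t := s.sub T hT)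
        (f := fun z => ⟨p (F.map m z), hZ.subset ⟨z, rfl⟩⟩) (fun z a => ?_) z u).symm⟩
    · obtain ⟨ξ, hξ⟩ := hp y.1
      obtain ⟨z, rfl⟩ := hZ.superset (show ξ ∈ p ⁻¹' T from by
        change p ξ ∈ T
        rw [hξ]
        exact y.2)
      exact ⟨z, Subtype.ext hξ⟩
    · exact Subtype.ext ((hps _ a).trans (congrArg p (act_map (g a) m z)))
  quotient_mem s t := by
    rintro ⟨X, p, hp, hps⟩ ⟨q, hq, hqt⟩
    exact ⟨X, q ∘ p, hq.comp hp, fun ξ u => (congrArg q (hps ξ u)).trans (hqt _ u)⟩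

theorem fiberEquivalent_letterVariety {g : A → FundamentalMonoid F}
    (hg : Dense (Submonoid.closure (Set.range g) : Set (FundamentalMonoid F)))
    (hF : IsSemiGalois F) :
    FiberEquivalent F (FinAction.fiberFunctor (letterVariety g)) := by
  let Φ : C ⥤ FinAction.DFACat (letterVariety g) :=
    (letterVariety g).lift (letterAction g) fun X =>
      ⟨X, id, Function.surjective_id, fun _ _ => rfl⟩
  have hfaithful : Φ.Faithful := ⟨fun {X Y f h} hfh => by
    have := hF.faithful
    refine F.map_injective (FintypeCat.hom_ext _ _ fun ξ => ?_)
    exact congrFun (congrArg (fun t => t.hom.toFun) hfh) ξ⟩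
  have hfull : Φ.Full := ⟨fun {X Y} t => by
    obtain ⟨f, hf⟩ := hF.exists_map_eq (X := X) (Y := Y) t.hom.toFun
      (act_map_of_dense hg hF fun a ξ => t.hom.map_run ξ [a])
    exact ⟨f, ObjectProperty.hom_ext _ (FinAction.Hom.ext (funext hf))⟩⟩
  have hsurj : Φ.EssSurj := ⟨fun s => by
    obtain ⟨X, p, hp, hps⟩ := exists_bijective_of_letterVariety hg hF s.property
    let e := Equiv.ofBijective p hp
    refine ⟨X, ⟨(letterVariety g).isoMk ⟨⟨p, FinAction.map_run_of_step
      (s := (letterAction g).obj X) hps⟩, ⟨e.symm, FinAction.map_run_of_step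
      (t := (letterAction g).obj X) fun y a => ?_⟩, ?_, ?_⟩⟩⟩
    · refine e.injective ?_
      refine (hps _ a).symm.trans ?_
      exact (congrArg (s.obj.step · a) (e.apply_symm_apply y)).trans (e.apply_symm_apply _).symm
    · exact FinAction.Hom.ext (funext e.symm_apply_apply)
    · exact FinAction.Hom.ext (funext e.apply_symm_apply)⟩
  have : Φ.IsEquivalence := {}
  exact ⟨Φ.asEquivalence, ⟨Iso.refl F⟩⟩

end LetterAction

/-! ### Density of the submonoid generated by the letters. -/

section Generators

variable {C : Type u} [Category.{v} C] {F : C ⥤ FintypeCat.{w}} {A : Type x}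
  {V : ObjectProperty (FinAction.{w} A)}

/-- Every letter is a natural endomorphism of the fiber functor. -/
def letterHom (V : ObjectProperty (FinAction.{w} A)) (a : A) :
    FinAction.fiberFunctor V ⟶ FinAction.fiberFunctor V where
  app s := FintypeCat.homMk (X := FintypeCat.of s.obj.State) (Y := FintypeCat.of s.obj.State)
    fun ξ => s.obj.step ξ a
  naturality _ _ f := FintypeCat.hom_ext _ _ fun ξ => f.hom.map_run ξ [a]

/-- The element of the fundamental monoid given by a letter. -/
def letter {E : C ⥤ FinAction.DFACat V} (α : E ⋙ FinAction.fiberFunctor V ≅ F) (a : A) :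
    FundamentalMonoid F :=
  ⟨α.inv ≫ Functor.whiskerLeft E (letterHom V a) ≫ α.hom⟩

theorem act_letter {E : C ⥤ FinAction.DFACat V} (α : E ⋙ FinAction.fiberFunctor V ≅ F) (a : A)
    (X : C) (ξ : (E.obj X).obj.State) :
    act (letter α a) X (α.hom.app X ξ) = α.hom.app X ((E.obj X).obj.step ξ a) := by
  have h : α.inv.app X (α.hom.app X ξ) = ξ :=
    ConcreteCategory.congr_hom (α.hom_inv_id_app X) ξ
  change α.hom.app X ((E.obj X).obj.step (α.inv.app X (α.hom.app X ξ)) a) = _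
  rw [h]

theorem act_prod_letter {E : C ⥤ FinAction.DFACat V} (α : E ⋙ FinAction.fiberFunctor V ≅ F)
    (u : List A) (X : C) (ξ : (E.obj X).obj.State) :
    act (u.map (letter α)).prod X (α.hom.app X ξ) = α.hom.app X ((E.obj X).obj.run ξ u) := by
  induction u generalizing ξ with
  | nil => rfl
  | cons a u ih =>
    rw [List.map_cons, List.prod_cons, act_mul, act_letter]
    exact ih _

theorem dense_closure_letter (hF : IsSemiGalois F) (hV : FinAction.IsLocalVariety V)
    (e : C ≌ FinAction.DFACat V) (α : e.functor ⋙ FinAction.fiberFunctor V ≅ F) :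
    Dense (Submonoid.closure (Set.range (letter α)) : Set (FundamentalMonoid F)) := by
  intro φ
  rw [mem_closure_iff_nhds_basis (nhds_hasBasis φ)]
  intro t ht
  have := hF.isCofiltered_elements
  -- One point `ξ` maps to all the points of `t`, so agreeing with `φ` at `ξ` suffices.
  obtain ⟨⟨X, ξ⟩, hX⟩ := IsCofiltered.inf_objs_exists
    (C := (F ⋙ FintypeCat.incl).Elements) ht.toFinset
  let s := (e.functor.obj X).obj
  let ξ' : s.State := α.inv.app X ξ
  have hξ' : α.hom.app X ξ' = ξ := ConcreteCategory.congr_hom (α.inv_hom_id_app X) ξ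
  -- The orbit of `ξ'` under words; closure of `V` under subactions is what makes it correspond to
  -- an object of `C`.
  let T : FinAction.DFACat V := ⟨s.sub _ (s.isStable_range_run ξ'),
    hV.sub_mem _ _ _ (e.functor.obj X).property⟩
  let ι : T ⟶ e.functor.obj X := ObjectProperty.homMk
    ⟨Subtype.val, FinAction.map_run_of_step (s := T.obj) fun _ _ => rfl⟩
  let c := e.counitIso.app T
  obtain ⟨h, hh⟩ : ∃ h : e.inverse.obj T ⟶ X, e.functor.map h = c.hom ≫ ι :=
    e.functor.map_surjective _
  let τ : T.obj.State := ⟨ξ', [], rfl⟩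
  let y : (e.functor.obj (e.inverse.obj T)).obj.State := c.inv.hom.toFun τ
  have hcc : ∀ z : (e.functor.obj (e.inverse.obj T)).obj.State,
      c.inv.hom.toFun (c.hom.hom.toFun z) = z := fun z =>
    congrFun (congrArg (fun t => t.hom.toFun) c.hom_inv_id) z
  have hcc' : ∀ z, c.hom.hom.toFun (c.inv.hom.toFun z) = z := fun z =>
    congrFun (congrArg (fun t => t.hom.toFun) c.inv_hom_id) z
  have hy : ∀ z : (e.functor.obj (e.inverse.obj T)).obj.State, ∃ u : List A,
      (e.functor.obj (e.inverse.obj T)).obj.run y u = z := by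
    intro z
    obtain ⟨u, hu⟩ := (c.hom.hom.toFun z).2
    refine ⟨u, ?_⟩
    refine (c.inv.hom.map_run τ u).trans (Eq.trans ?_ (hcc z))
    refine congrArg c.inv.hom.toFun (Subtype.ext ?_)
    exact (s.run_sub (s.isStable_range_run ξ') τ u).trans hu
  have hhy : F.map h (α.hom.app _ y) = ξ := by
    refine (ConcreteCategory.congr_hom (α.hom.naturality h) y).symm.trans ?_
    refine Eq.trans (congrArg (α.hom.app X) ?_) hξ'
    change (e.functor.map h).hom.toFun y = ξ'
    rw [hh]
    exact congrArg Subtype.val (hcc' τ)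
  -- Since `φ` acts on the fiber of the object matching `T`, it sends the point of `y` to a state
  -- that a word reaches from `y`.
  obtain ⟨u, hu⟩ := hy (α.inv.app _ (act φ _ (α.hom.app _ y)))
  have hφ : act (u.map (letter α)).prod _ (α.hom.app _ y) = act φ _ (α.hom.app _ y) := by
    rw [act_prod_letter, hu]
    exact ConcreteCategory.congr_hom (α.inv_hom_id_app _) _
  refine ⟨(u.map (letter α)).prod, Submonoid.list_prod_mem _ fun ψ hψ => ?_, ?_⟩
  · obtain ⟨a, -, rfl⟩ := List.mem_map.1 hψ
    exact Submonoid.subset_closure ⟨a, rfl⟩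
  · rw [Set.mem_iInter₂]
    rintro ⟨W, ω⟩ hi
    obtain ⟨k, hk⟩ : ∃ k : X ⟶ W, F.map k ξ = ω :=
      let ⟨k⟩ := hX (ht.mem_toFinset.2 hi)
      ⟨k.1, k.2⟩
    change act _ W ω = act _ W ω
    rw [← hk, ← hhy, act_map, act_map, act_map, act_map, hφ]

end Generators

end SemiGalois

theorem mainTheorem7 {C : Type u} [Category.{v} C] (F : C ⥤ FintypeCat.{w})
    (hF : SemiGalois.IsSemiGalois F) (A : Type x) [Finite A] [Nonempty A] :
    (∃ V : ObjectProperty (SemiGalois.FinAction.{w} A),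
        SemiGalois.FinAction.IsLocalVariety V ∧
          SemiGalois.FiberEquivalent F (SemiGalois.FinAction.fiberFunctor V)) ↔
      SemiGalois.IsTopologicallyGeneratedBy (SemiGalois.FundamentalMonoid F) (Nat.card A) := by
  constructor
  · rintro ⟨V, hV, e, ⟨α⟩⟩
    refine ⟨SemiGalois.letter α ∘ (Finite.equivFin A).symm, ?_⟩
    rw [(Finite.equivFin A).symm.surjective.range_comp]
    exact SemiGalois.dense_closure_letter hF hV e α
  · rintro ⟨g, hg⟩
    have hg' : Dense (Submonoid.closure (Set.range (g ∘ Finite.equivFin A)) :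
        Set (SemiGalois.FundamentalMonoid F)) := by
      rwa [(Finite.equivFin A).surjective.range_comp]
    exact ⟨_, SemiGalois.isLocalVariety_letterVariety hg' hF,
      SemiGalois.fiberEquivalent_letterVariety hg' hF⟩
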